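/- **Setting.** An instance of Multistage Min-Sum Set Cover (Mult-MSSC) consists of a finite universe $U$ of $n$ elements, nonempty requests $R_1,\dots,R_T\subseteq U$ and an initial permutation $\pi^0$ of $U$. A solution is a sequence of permutations $\pi^1,\dots,\pi^T$. Its *moving cost* is $\sum_{t=1}^T d_{KT}(\pi^t,\pi^{t-1})$, where $d_{KT}$ (Kendall tau distance) is the number of inverted pairs of elements. Its *covering cost* is $\sum_{t=1}^T \pi^t(R_t)$, where $\pi^t(R_t)$ is the position of the first element of $R_t$ in $\pi^t$. Its cost is the sum of the two, and $\mathrm{OPT}$ is the minimum cost. For $n\times n$ stochastic matrices (rows are elements, columns are positions) let $d_{FR}(A,B)$ be the minimum of $\sum_{e,i,j}|i-j|f^e_{ij}$ over $f\ge 0$ with $\sum_i f^e_{ij}=B_{ej}$ and $\sum_j f^e_{ij}=A_{ei}$ for all $e,i,j$. The linear program *Fractional-MTF* minimizes $\sum_{t=1}^T d_{FR}(A^t,A^{t-1})$ over doubly stochastic matrices $A^1,\dots,A^T$ with $\sum_{e\in R_t}A^t_{e1}=1$ for all $t$, where $A^0$ is the 0-1 matrix of $\pi^0$. *Dependent randomized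 rounding* of an optimal solution $(A^t)_t$ of Fractional-MTF: draw for each element $e$ one threshold $\alpha_e$, independently and uniformly from $[0,1]$. For each $t=1,\dots,T$ and each $e$ let $I^t_e$ be the least $i\in\{1,\dots,n\}$ with $\log n\cdot\sum_{s=1}^i A^t_{es}\ge\alpha_e$, where $\log$ is the natural logarithm (and $I^t_e=n$ if there is no such $i$, which can happen only for $n\le 2$). Let $\pi^t$ be the permutation that sorts the elements by increasing $I^t_e$, with ties broken according to a fixed linear order of $U$. **Theorem.** For every instance, every fixed linear order of $U$ and every optimal solution of Fractional-MTF, the random solution $\pi^1,\dots,\pi^T$ satisfies $$\mathbb E\Big[\sum_{t=1}^T d_{KT}(\pi^t,\pi^{t-1})\Big]\le 4\log^2 n\cdot \mathrm{OPT}$$ and, for every optimal solution $\pi^1_{\mathrm{Opt}},\dots,\pi^T_{\mathrm{Opt}}$ of Mult-MSSC, $$\mathbb E\Big[\sum_{t=1}^T \pi^t(R_t)\Big]\le 2\sum_{t=1}^T\pi^t_{\mathrm{Opt}}(R_t).$$ Consequently the rounding is an $O(\log^2 n)$-approximation: there is an absolute constant $C>0$ such that, for all instances with $n\ge 2$, the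 expected cost of $\pi^1,\dots,\pi^T$ is at most $C\log^2 n\cdot\mathrm{OPT}$. -/

import Mathlib

open MeasureTheory

namespace MultMSSC

/-! ### Permutations of the universe, Kendall tau distance, covering cost -/

/-- A permutation (ranking) of the `n` elements of the universe `U`: it sends each element to its
place, the places being numbered `0, …, n - 1`. -/
abbrev Ranking (U : Type*) [Fintype U] : Type _ := U ≃ Fin (Fintype.card U)

/-- The position `1 ≤ Pos(e, π) ≤ n` of the element `e` in `π`. -/
def pos {U : Type*} [Fintype U] (π : Ranking U) (e : U) : ℕ := (π e : ℕ) + 1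

/-- Kendall tau distance: the number of inverted pairs. An unordered inverted pair `{e, e'}` is
counted once, at its ordering `(e, e')` with `e` behind `e'` in `π` and before `e'` in `σ`. -/
def kendallTau {U : Type*} [Fintype U] (π σ : Ranking U) : ℕ :=
  (Finset.univ.filter fun p : U × U => pos π p.2 < pos π p.1 ∧ pos σ p.1 < pos σ p.2).card

/-- `π(R)`: the position of the first element of `R` in `π` (used for nonempty `R`). -/
noncomputable def coverPos {U : Type*} [Fintype U] (π : Ranking U) (R : Finset U) : ℕ :=
  sInf {i : ℕ | ∃ e ∈ R, pos π e = i}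

/-! ### Multistage min-sum set cover

The request of round `t + 1` is `R t`, `t = 0, …, T - 1`; a sequence of permutations is indexed by
`0, …, T`, so that round `t + 1` moves from `σ t.castSucc` to `σ t.succ`. -/

/-- Moving cost `∑ₜ d_KT(σᵗ, σᵗ⁻¹)`. -/
def movingCost {U : Type*} [Fintype U] {T : ℕ} (σ : Fin (T + 1) → Ranking U) : ℕ :=
  ∑ t : Fin T, kendallTau (σ t.succ) (σ t.castSucc)

/-- Covering cost `∑ₜ σᵗ(Rₜ)`. -/
noncomputable def coveringCost {U : Type*} [Fintype U] {T : ℕ} (R : Fin T → Finset U)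
    (σ : Fin (T + 1) → Ranking U) : ℕ :=
  ∑ t : Fin T, coverPos (σ t.succ) (R t)

/-- The cost of a sequence of permutations. -/
noncomputable def totalCost {U : Type*} [Fintype U] {T : ℕ} (R : Fin T → Finset U)
    (σ : Fin (T + 1) → Ranking U) : ℕ :=
  coveringCost R σ + movingCost σ

/-- The optimal cost: the minimum cost of a sequence of permutations that starts at `π₀`. -/
noncomputable def optCost {U : Type*} [Fintype U] {T : ℕ} (R : Fin T → Finset U)
    (π₀ : Ranking U) : ℕ :=
  sInf {c : ℕ | ∃ σ : Fin (T + 1) → Ranking U, σ 0 = π₀ ∧ totalCost R σ = c}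

/-- `σ` is an optimal solution of the instance `(R, π₀)`. -/
def IsOptimalSolution {U : Type*} [Fintype U] {T : ℕ} (R : Fin T → Finset U)
    (π₀ : Ranking U) (σ : Fin (T + 1) → Ranking U) : Prop :=
  σ 0 = π₀ ∧ totalCost R σ = optCost R π₀

/-! ### The linear program Fractional-MTF -/

/-- Element-by-position matrices. -/
abbrev PosMatrix (U : Type*) [Fintype U] : Type _ := Matrix U (Fin (Fintype.card U)) ℝ

/-- The 0-1 matrix of a permutation. -/
def permMatrix {U : Type*} [Fintype U] (π : Ranking U) : PosMatrix U :=
  fun e i => if π e = i then 1 else 0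

/-- `f e i j` is the mass that row `e` transports from column `i` to column `j`; the plan turns
each row of `A` into the corresponding row of `B`. -/
structure IsTransportPlan {U : Type*} [Fintype U] (A B : PosMatrix U)
    (f : U → Fin (Fintype.card U) → Fin (Fintype.card U) → ℝ) : Prop where
  nonneg : ∀ e i j, 0 ≤ f e i j
  arriving : ∀ e j, ∑ i, f e i j = B e j
  leaving : ∀ e i, ∑ j, f e i j = A e i

/-- Cost of a transport plan. -/
def transportCost {U : Type*} [Fintype U]
    (f : U → Fin (Fintype.card U) → Fin (Fintype.card U) → ℝ) : ℝ :=
  ∑ e, ∑ i : Fin (Fintype.card U), ∑ j : Fin (Fintype.card U), |((i : ℕ) : ℝ) - ((j : ℕ) : ℝ)| * f e i j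

/-- Footrule distance of two stochastic matrices: the optimal value of the transport problem. -/
noncomputable def footrule {U : Type*} [Fintype U] (A B : PosMatrix U) : ℝ :=
  sInf {c : ℝ | ∃ f, IsTransportPlan A B f ∧ transportCost f = c}

/-- Feasibility for Fractional-MTF: `A⁰` is the initial permutation, and for every round the matrix
is doubly stochastic and its first column is carried by the requested set. -/
structure IsFracMTFFeasible {U : Type*} [Fintype U] {T : ℕ} (R : Fin T → Finset U)
    (π₀ : Ranking U) (A : Fin (T + 1) → PosMatrix U) : Prop where
  init : A 0 = permMatrix π₀
  nonneg : ∀ (t : Fin T) e i, 0 ≤ A t.succ e i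
  row_sum : ∀ (t : Fin T) e, ∑ i, A t.succ e i = 1
  col_sum : ∀ (t : Fin T) i, ∑ e, A t.succ e i = 1
  first_col : ∀ (t : Fin T) (i : Fin (Fintype.card U)), (i : ℕ) = 0 →
    ∑ e ∈ R t, A t.succ e i = 1

/-- Objective of Fractional-MTF: `∑ₜ d_FR(Aᵗ, Aᵗ⁻¹)`. -/
noncomputable def fracMTFCost {U : Type*} [Fintype U] {T : ℕ} (A : Fin (T + 1) → PosMatrix U) : ℝ :=
  ∑ t : Fin T, footrule (A t.succ) (A t.castSucc)

/-- `A` is an optimal solution of Fractional-MTF. -/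
def IsFracMTFOptimal {U : Type*} [Fintype U] {T : ℕ} (R : Fin T → Finset U)
    (π₀ : Ranking U) (A : Fin (T + 1) → PosMatrix U) : Prop :=
  IsFracMTFFeasible R π₀ A ∧
    ∀ B : Fin (T + 1) → PosMatrix U, IsFracMTFFeasible R π₀ B → fracMTFCost A ≤ fracMTFCost B

/-! ### Dependent randomized rounding -/

/-- The index of `e`: the least place `i` such that `log n` times the mass of row `e` on the places
up to `i` reaches the threshold `α e`. For `n ≥ 3` and thresholds in `[0, 1]` such a place exists,
since `log n ≥ 1`; if there is none, the index is the last place `n - 1`. -/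
noncomputable def roundIndex {U : Type*} [Fintype U] (A : PosMatrix U) (α : U → ℝ) (e : U) : ℕ :=
  sInf {i : ℕ | i + 1 = Fintype.card U ∨ ∃ h : i < Fintype.card U,
    α e ≤ Real.log (Fintype.card U) * ∑ s ∈ Finset.Iic (⟨i, h⟩ : Fin (Fintype.card U)), A e s}

/-- The number of elements sorted before `e` if elements are sorted by increasing index and ties
are broken by the fixed linear order of `U`. -/
def sortRank {U : Type*} [Fintype U] [LinearOrder U] (I : U → ℕ) (e : U) : ℕ :=
  (Finset.univ.filter fun f : U => I f < I e ∨ (I f = I e ∧ f < e)).card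

theorem sortRank_lt_card {U : Type*} [Fintype U] [LinearOrder U] (I : U → ℕ) (e : U) :
    sortRank I e < Fintype.card U := by
  unfold sortRank
  rw [← Finset.card_univ]
  apply Finset.card_lt_card
  rw [Finset.ssubset_univ_iff]
  intro h
  have he := Finset.mem_univ e
  rw [← h] at he
  simp at he

theorem sortRank_lt_sortRank {U : Type*} [Fintype U] [LinearOrder U] (I : U → ℕ) {e e' : U}
    (h : I e < I e' ∨ (I e = I e' ∧ e < e')) : sortRank I e < sortRank I e' := by
  unfold sortRank
  apply Finset.card_lt_card
  rw [Finset.ssubset_iff_of_subset]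
  · exact ⟨e, by simpa using h, by simp⟩
  · intro f hf
    simp only [Finset.mem_filter, Finset.mem_univ, true_and] at hf ⊢
    rcases hf with hf | ⟨hf, hf'⟩ <;> rcases h with h | ⟨h, h'⟩
    · left; omega
    · left; omega
    · left; omega
    · right; exact ⟨hf.trans h, hf'.trans h'⟩

theorem sortRank_bijective {U : Type*} [Fintype U] [LinearOrder U] (I : U → ℕ) :
    Function.Bijective fun e : U => (⟨sortRank I e, sortRank_lt_card I e⟩ :
      Fin (Fintype.card U)) := by
  rw [Fintype.bijective_iff_injective_and_card]
  refine ⟨fun e e' h => ?_, by simp⟩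
  simp only [Fin.mk.injEq] at h
  by_contra hne
  rcases lt_trichotomy (I e) (I e') with hI | hI | hI
  · exact absurd h (sortRank_lt_sortRank I (Or.inl hI)).ne
  · rcases lt_or_gt_of_ne hne with hl | hl
    · exact absurd h (sortRank_lt_sortRank I (Or.inr ⟨hI, hl⟩)).ne
    · exact absurd h (sortRank_lt_sortRank I (Or.inr ⟨hI.symm, hl⟩)).ne'
  · exact absurd h (sortRank_lt_sortRank I (Or.inl hI)).ne'

/-- The permutation that sorts the elements by increasing index, ties being broken by the fixed
linear order of `U`. -/
noncomputable def sortRanking {U : Type*} [Fintype U] [LinearOrder U] (I : U → ℕ) : Ranking U :=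
  Equiv.ofBijective _ (sortRank_bijective I)

/-- The sequence `π⁰, π¹, …, πᵀ` produced by the rounding: it starts at the given permutation, and
all rounds use the same thresholds `α`. -/
noncomputable def roundedSchedule {U : Type*} [Fintype U] [LinearOrder U] {T : ℕ}
    (π₀ : Ranking U) (A : Fin (T + 1) → PosMatrix U) (α : U → ℝ) : Fin (T + 1) → Ranking U :=
  Fin.cons π₀ fun t : Fin T => sortRanking (roundIndex (A t.succ) α)

/-- The law of the thresholds: independent and uniform on `[0, 1]`, one for each element. -/
noncomputable def thresholdLaw (U : Type*) [Fintype U] : Measure (U → ℝ) :=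
  Measure.pi fun _ : U => (volume : Measure ℝ).restrict (Set.Icc 0 1)

end MultMSSC

/-!
Two inequalities give the bound on the moving cost, with `n` the number of elements.

*Fractional-MTF costs at most `2 * OPT`* (`fracMTFCost_le_two_mul_totalCost`). For a schedule `σ`
there is a feasible integral solution `τ` in which no element is more than one place behind its
place in `σ` (`Follows`). If `σ` exchanges two neighbours, one exchange of neighbours in `τ`, of
footrule length `2`, restores the invariant. If a set is requested whose first element `e` in `σ`
has position `p`, then `e` has position at most `p + 1` in `τ`, and it reaches the front of `τ`
through exchanges that cost at most `2 * p` in total: as long as `e` is at position `q + 1 > 1`,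
one of the `q` elements before it is not among the first `q - 1` elements of `σ`, and this one can
trade places with `e`.

*A round of the rounding makes at most `2 * log² n` times the footrule distance of its two matrices
inversions in expectation* (`integral_kendallTau_le`). Almost surely the index of `e` is below `k`
exactly if the threshold of `e` is at most `log n` times the mass of row `e` on the first `k`
columns. Hence `e` jumps over the gap between two neighbouring places with probability at most
`log n` times the difference of the prefix masses there, and these differences add up to at most
the footrule distance (`sum_prefixMass_sub_le_footrule`). In an inversion one of the elements jumps
over a gap at an end of which the other one lies (`exists_crossing`). The thresholds of the two are
independent, and the expected number of elements at the two ends of a gap is at most `2 * log n`,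
because the columns of the matrices have sum `1`.

For the covering cost (`integral_coverPos_le`), only requested elements can have the first index,
so a request costs `1` unless none of its elements has the first index; that has probability at
most `∏ (1 - log n * A e 1) ≤ exp (-log n) = 1 / n`, and the cost never exceeds `n`.

The bounds for a round need `log n ≥ 1`, that is `n ≥ 3`. For `n ≤ 2` the claims hold for every
value of the thresholds: no request costs more than `2`, a round makes at most one inversion (none
for `n ≤ 1`), and every schedule pays at least `1` for each request.
-/

namespace MultMSSC

/-! ### The footrule distance of matrices -/

theorem transportCost_nonneg {U : Type*} [Fintype U] {A B : PosMatrix U}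
    {f : U → Fin (Fintype.card U) → Fin (Fintype.card U) → ℝ} (hf : IsTransportPlan A B f) :
    0 ≤ transportCost f :=
  Finset.sum_nonneg fun e _ => Finset.sum_nonneg fun i _ => Finset.sum_nonneg fun j _ =>
    mul_nonneg (abs_nonneg _) (hf.nonneg e i j)

theorem footrule_le_transportCost {U : Type*} [Fintype U] {A B : PosMatrix U}
    {f : U → Fin (Fintype.card U) → Fin (Fintype.card U) → ℝ} (hf : IsTransportPlan A B f) :
    footrule A B ≤ transportCost f :=
  csInf_le ⟨0, by rintro _ ⟨g, hg, rfl⟩; exact transportCost_nonneg hg⟩ ⟨f, hf, rfl⟩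

theorem footrule_permMatrix_le {U : Type*} [Fintype U] (π σ : Ranking U) :
    footrule (permMatrix π) (permMatrix σ) ≤ ∑ e, |((π e : ℕ) : ℝ) - ((σ e : ℕ) : ℝ)| := by
  have hf : IsTransportPlan (permMatrix π) (permMatrix σ)
      (fun e i j => if π e = i then (if σ e = j then 1 else 0) else 0) := by
    refine ⟨fun e i j => ?_, fun e j => ?_, fun e i => ?_⟩
    · split_ifs <;> norm_num
    · simp [permMatrix]
    · by_cases h : π e = i <;> simp [permMatrix, h]
  refine (footrule_le_transportCost hf).trans (le_of_eq ?_)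
  simp [transportCost]

/-- The mass of row `e` on the first `k` columns. -/
def prefixMass {U : Type*} [Fintype U] (A : PosMatrix U) (e : U) (k : ℕ) : ℝ :=
  ∑ s : Fin (Fintype.card U), if (s : ℕ) < k then A e s else 0

theorem prefixMass_sub_le {U : Type*} [Fintype U] {A B : PosMatrix U}
    {f : U → Fin (Fintype.card U) → Fin (Fintype.card U) → ℝ} (hf : IsTransportPlan A B f)
    (e : U) (k : ℕ) :
    |prefixMass A e k - prefixMass B e k| ≤
      ∑ i : Fin (Fintype.card U), ∑ j : Fin (Fintype.card U),
        |(if (i : ℕ) < k then (1 : ℝ) else 0) - (if (j : ℕ) < k then 1 else 0)| * f e i j := by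
  have hA : prefixMass A e k = ∑ i : Fin (Fintype.card U), ∑ j : Fin (Fintype.card U),
      (if (i : ℕ) < k then (1 : ℝ) else 0) * f e i j := by
    refine Finset.sum_congr rfl fun i _ => ?_
    rw [← Finset.mul_sum, hf.leaving]; split_ifs <;> simp
  have hB : prefixMass B e k = ∑ i : Fin (Fintype.card U), ∑ j : Fin (Fintype.card U),
      (if (j : ℕ) < k then (1 : ℝ) else 0) * f e i j := by
    rw [Finset.sum_comm]
    refine Finset.sum_congr rfl fun j _ => ?_
    rw [← Finset.mul_sum, hf.arriving]; split_ifs <;> simp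
  rw [hA, hB, ← Finset.sum_sub_distrib]
  refine (Finset.abs_sum_le_sum_abs _ _).trans (Finset.sum_le_sum fun i _ => ?_)
  rw [← Finset.sum_sub_distrib]
  refine (Finset.abs_sum_le_sum_abs _ _).trans (Finset.sum_le_sum fun j _ => ?_)
  rw [← sub_mul, abs_mul, abs_of_nonneg (hf.nonneg e i j)]

theorem sum_abs_indicator_sub_le (i j n : ℕ) :
    ∑ k ∈ Finset.range n, |(if i < k + 1 then (1 : ℝ) else 0) - (if j < k + 1 then 1 else 0)| ≤
      |(i : ℝ) - (j : ℝ)| := by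
  wlog h : i ≤ j generalizing i j
  · have := this j i (le_of_not_ge h)
    rw [abs_sub_comm (i : ℝ)]
    refine le_trans (le_of_eq (Finset.sum_congr rfl fun k _ => abs_sub_comm _ _)) this
  have h1 : ∀ k ∈ Finset.range n,
      |(if i < k + 1 then (1 : ℝ) else 0) - (if j < k + 1 then 1 else 0)| =
        if k ∈ Finset.Ico i j then 1 else 0 := by
    intro k _
    simp only [Finset.mem_Ico]
    split_ifs <;> first | omega | simp
  rw [Finset.sum_congr rfl h1, Finset.sum_boole, abs_sub_comm, abs_of_nonneg
    (by simpa using h), ← Nat.cast_sub h, ← Nat.card_Ico]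
  exact_mod_cast Finset.card_le_card fun k hk => (Finset.mem_filter.1 hk).2

/-- The easy half of the formula for the transport distance on a line: a plan must carry the
surplus of prefix mass across each gap between consecutive columns. -/
theorem sum_prefixMass_sub_le_footrule {U : Type*} [Fintype U] {A B : PosMatrix U}
    (hA : ∀ e i, 0 ≤ A e i) (hA1 : ∀ e, ∑ i, A e i = 1)
    (hB : ∀ e i, 0 ≤ B e i) (hB1 : ∀ e, ∑ i, B e i = 1) :
    ∑ e, ∑ k ∈ Finset.range (Fintype.card U), |prefixMass A e (k + 1) - prefixMass B e (k + 1)| ≤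
      footrule A B := by
  -- the product plan shows that the set of costs is nonempty, so that `sInf` is no junk value
  refine le_csInf ⟨_, fun e i j => A e i * B e j, ⟨fun e i j => mul_nonneg (hA e i) (hB e j),
    fun e j => by rw [← Finset.sum_mul, hA1, one_mul],
    fun e i => by rw [← Finset.mul_sum, hB1, mul_one]⟩, rfl⟩ ?_
  rintro _ ⟨f, hf, rfl⟩
  refine Finset.sum_le_sum fun e _ => ?_
  refine (Finset.sum_le_sum fun k _ => prefixMass_sub_le hf e (k + 1)).trans ?_
  rw [Finset.sum_comm]
  refine Finset.sum_le_sum fun i _ => ?_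
  rw [Finset.sum_comm]
  refine Finset.sum_le_sum fun j _ => ?_
  rw [← Finset.sum_mul]
  exact mul_le_mul_of_nonneg_right (sum_abs_indicator_sub_le i j _) (hf.nonneg e i j)

/-! ### Fractional-MTF costs at most twice the optimum -/

/-- Spearman's footrule of two permutations. -/
def spearman {U : Type*} [Fintype U] (π σ : Ranking U) : ℝ :=
  ∑ e, |((π e : ℕ) : ℝ) - ((σ e : ℕ) : ℝ)|

theorem spearman_triangle {U : Type*} [Fintype U] (π σ τ : Ranking U) :
    spearman π τ ≤ spearman π σ + spearman σ τ := by
  unfold spearman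
  rw [← Finset.sum_add_distrib]
  exact Finset.sum_le_sum fun e _ => abs_sub_le _ _ _

@[simp] theorem spearman_self {U : Type*} [Fintype U] (π : Ranking U) : spearman π π = 0 := by
  simp [spearman]

/-- Exchanging two elements at distance `d` costs `2 * d`. -/
theorem spearman_swap {U : Type*} [Fintype U] [DecidableEq U] (τ : Ranking U) (x y : U) :
    spearman ((Equiv.swap x y).trans τ) τ = 2 * |((τ x : ℕ) : ℝ) - ((τ y : ℕ) : ℝ)| := by
  by_cases hxy : x = y
  · subst hxy; simp
  unfold spearman
  rw [← Finset.sum_subset (Finset.subset_univ {x, y}), Finset.sum_pair hxy]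
  · simp only [Equiv.trans_apply, Equiv.swap_apply_left, Equiv.swap_apply_right]
    rw [abs_sub_comm]; ring
  · intro z _ hz
    simp only [Finset.mem_insert, Finset.mem_singleton, not_or] at hz
    simp [Equiv.swap_apply_of_ne_of_ne hz.1 hz.2]

/-- No element of `τ` is more than one place behind its place in `σ`. This leaves room for the one
element that has been moved to the front. -/
def Follows {U : Type*} [Fintype U] (τ σ : Ranking U) : Prop :=
  ∀ x, (τ x : ℕ) ≤ (σ x : ℕ) + 1

/-- Serving a request for `e`: the front is reached by exchanges that each send one element to the
right, and the pigeonhole principle finds an element for which this preserves `Follows`. -/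
theorem Follows.exists_front {U : Type*} [Fintype U] [DecidableEq U] {τ σ : Ranking U}
    (h : Follows τ σ) (e : U) :
    ∃ τ' : Ranking U, Follows τ' σ ∧ (τ' e : ℕ) = 0 ∧ spearman τ' τ ≤ 2 * ((τ e : ℕ) : ℝ) := by
  induction hq : (τ e : ℕ) using Nat.strong_induction_on generalizing τ with
  | _ q ih =>
  rcases Nat.eq_zero_or_pos q with hq0 | hq0
  · exact ⟨τ, h, hq.trans hq0, by simp⟩
  -- the first `q` places of `τ` cannot all be filled from the first `q - 1` places of `σ`
  obtain ⟨w, hw1, hw2⟩ : ∃ w, (τ w : ℕ) < q ∧ q ≤ (σ w : ℕ) + 1 := by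
    by_contra! hcon
    have hqn : q < Fintype.card U := hq ▸ (τ e).2
    have hmaps : ∀ i : Fin q, (σ (τ.symm ⟨i, i.2.trans hqn⟩) : ℕ) < q - 1 := fun i => by
      have := hcon (τ.symm ⟨i, i.2.trans hqn⟩) (by simp)
      omega
    have hinj : Function.Injective
        (fun i : Fin q => (⟨_, hmaps i⟩ : Fin (q - 1))) := by
      intro i j hij
      simp only [Fin.mk.injEq] at hij
      have := τ.symm.injective (σ.injective (Fin.ext hij))
      simpa [Fin.ext_iff] using this
    have := Fintype.card_le_of_injective _ hinj
    simp only [Fintype.card_fin] at this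
    omega
  have hne : e ≠ w := by rintro rfl; omega
  have hτe : ((Equiv.swap e w).trans τ) e = τ w := by simp
  have hfol : Follows ((Equiv.swap e w).trans τ) σ := by
    intro x
    by_cases hxe : x = e
    · subst hxe
      have := h x
      rw [hτe]; omega
    by_cases hxw : x = w
    · subst hxw
      simp only [Equiv.trans_apply, Equiv.swap_apply_right]; omega
    · simpa [Equiv.swap_apply_of_ne_of_ne hxe hxw] using h x
  obtain ⟨τ', h1, h2, h3⟩ := ih (τ w) hw1 hfol (by rw [hτe])
  refine ⟨τ', h1, h2, ?_⟩
  have h4 := spearman_triangle τ' ((Equiv.swap e w).trans τ) τ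
  have hlt : ((τ w : ℕ) : ℝ) ≤ q := by exact_mod_cast hw1.le
  rw [spearman_swap, hq, abs_of_nonneg (by linarith)] at h4
  linarith

/-- Following an exchange of two consecutive elements of `σ` needs at most one exchange of two
consecutive elements of `τ`. -/
theorem Follows.exists_swap {U : Type*} [Fintype U] [DecidableEq U] {τ σ : Ranking U}
    (h : Follows τ σ) {x y : U} (hxy : (σ y : ℕ) = (σ x : ℕ) + 1) :
    ∃ τ' : Ranking U, Follows τ' ((Equiv.swap x y).trans σ) ∧ spearman τ' τ ≤ 2 := by
  have hne : x ≠ y := by rintro rfl; omega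
  by_cases hy : (τ y : ℕ) ≤ (σ x : ℕ) + 1
  · refine ⟨τ, fun z => ?_, by simp⟩
    have hz := h z
    by_cases hzx : z = x
    · subst hzx; simp only [Equiv.trans_apply, Equiv.swap_apply_left]; omega
    by_cases hzy : z = y
    · subst hzy; simpa using hy
    · simpa [Equiv.swap_apply_of_ne_of_ne hzx hzy] using hz
  have hy' : (τ y : ℕ) = (σ x : ℕ) + 2 := by have := h y; omega
  obtain ⟨z, hz⟩ : ∃ z, (τ z : ℕ) = (σ x : ℕ) + 1 :=
    ⟨τ.symm ⟨(σ x : ℕ) + 1, by have := (τ y).2; omega⟩, by simp⟩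
  have hzy : y ≠ z := by rintro rfl; omega
  refine ⟨(Equiv.swap y z).trans τ, fun u => ?_, ?_⟩
  · have hu := h u
    by_cases huy : u = y
    · subst huy; simp [hz]
    by_cases huz : u = z
    · subst huz
      have : (σ x : ℕ) + 1 ≤ ((Equiv.swap x y).trans σ u : ℕ) := by
        by_cases hux : u = x
        · subst hux; simp [hxy]
        · -- the places `σ x` and `σ x + 1` are taken by `x` and `y`
          have h1 : (σ u : ℕ) ≠ σ x := fun h => hux (σ.injective (Fin.ext h))
          have h2 : (σ u : ℕ) ≠ σ y := fun h => huy (σ.injective (Fin.ext h))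
          simp only [Equiv.trans_apply, Equiv.swap_apply_of_ne_of_ne hux huy]
          omega
      simp only [Equiv.trans_apply, Equiv.swap_apply_right] at this ⊢
      omega
    by_cases hux : u = x
    · subst hux
      simp only [Equiv.trans_apply, Equiv.swap_apply_of_ne_of_ne huy huz, Equiv.swap_apply_left]
      omega
    · simpa [Equiv.swap_apply_of_ne_of_ne huy huz, Equiv.swap_apply_of_ne_of_ne hux huy] using hu
  · rw [spearman_swap, hy', hz]
    push_cast
    norm_num

/-- Two different permutations disagree on some pair that is consecutive in the second one. -/
theorem exists_adjacent_inversion {U : Type*} [Fintype U] {π σ : Ranking U} (h : π ≠ σ) :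
    ∃ x y, (σ y : ℕ) = (σ x : ℕ) + 1 ∧ π y < π x := by
  by_contra! hcon
  apply h
  have hmono : StrictMono (σ.symm.trans π) := by
    intro i j hij
    obtain ⟨d, hd⟩ : ∃ d, (j : ℕ) = i + d + 1 := ⟨j - i - 1, by
      have : (i : ℕ) < j := hij
      omega⟩
    induction d generalizing j with
    | zero =>
      have h1 := hcon (σ.symm i) (σ.symm j) (by simpa using hd)
      exact lt_of_le_of_ne h1 fun h2 => by
        have := σ.symm.injective (π.injective h2)
        exact hij.ne this
    | succ d ih =>
      let j' : Fin (Fintype.card U) := ⟨i + d + 1, by have := j.2; omega⟩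
      have h1 := ih (j := j') (by change (i : ℕ) < i + d + 1; omega) rfl
      have h2 := hcon (σ.symm j') (σ.symm j) (by simp [j', hd]; omega)
      exact lt_of_lt_of_le h1 h2
  have hid : RelIso.refl _ = hmono.orderIsoOfSurjective _ (σ.symm.trans π).surjective :=
    Subsingleton.elim _ _
  ext x
  have := congrArg (fun g : Fin (Fintype.card U) ≃o Fin (Fintype.card U) => (g (σ x) : ℕ)) hid
  simpa using this.symm

theorem kendallTau_swap_lt {U : Type*} [Fintype U] [DecidableEq U] {π σ : Ranking U} {x y : U}
    (hxy : (σ y : ℕ) = (σ x : ℕ) + 1) (hπ : π y < π x) :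
    kendallTau π ((Equiv.swap x y).trans σ) < kendallTau π σ := by
  have hne : x ≠ y := by rintro rfl; omega
  have hinj : ∀ u v, (σ u : ℕ) = σ v → u = v := fun u v h => σ.injective (Fin.ext h)
  unfold kendallTau
  apply Finset.card_lt_card
  rw [Finset.ssubset_iff_of_subset]
  · refine ⟨(x, y), ?_, ?_⟩
    · simp only [Finset.mem_filter, Finset.mem_univ, true_and]
      simp only [pos]
      exact ⟨by have : (π y : ℕ) < π x := hπ
                omega, by omega⟩
    · simp only [Finset.mem_filter, Finset.mem_univ, true_and]
      simp only [pos, Equiv.trans_apply,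
        Equiv.swap_apply_left, Equiv.swap_apply_right]
      omega
  · rintro ⟨u, v⟩
    have hπ' : (π y : ℕ) < π x := hπ
    simp only [Finset.mem_filter, Finset.mem_univ, true_and]
    simp only [pos, Equiv.trans_apply,
      Equiv.swap_apply_def]
    rintro ⟨h1, h2⟩
    refine ⟨h1, ?_⟩
    have h3 := hinj u x
    have h4 := hinj u y
    have h5 := hinj v x
    have h6 := hinj v y
    split_ifs at h2 <;> grind

/-- Following a change from `σ` to `π` costs at most twice the Kendall tau distance. -/
theorem Follows.exists_follows {U : Type*} [Fintype U] [DecidableEq U] {τ σ : Ranking U}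
    (h : Follows τ σ) (π : Ranking U) :
    ∃ τ' : Ranking U, Follows τ' π ∧ spearman τ' τ ≤ 2 * (kendallTau π σ : ℝ) := by
  induction hk : kendallTau π σ using Nat.strong_induction_on generalizing τ σ with
  | _ k ih =>
  by_cases hπ : π = σ
  · subst hπ; exact ⟨τ, h, by simp⟩
  obtain ⟨x, y, hxy, hyx⟩ := exists_adjacent_inversion hπ
  obtain ⟨τ₁, h1, h2⟩ := h.exists_swap hxy
  have hlt := kendallTau_swap_lt hxy hyx
  obtain ⟨τ', h3, h4⟩ := ih _ (hk ▸ hlt) h1 rfl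
  refine ⟨τ', h3, ?_⟩
  have h5 := spearman_triangle τ' τ₁ τ
  have h6 : (kendallTau π ((Equiv.swap x y).trans σ) : ℝ) + 1 ≤ k := by
    exact_mod_cast hk ▸ hlt
  linarith

theorem exists_pos_eq_coverPos {U : Type*} [Fintype U] (π : Ranking U) {R : Finset U}
    (hR : R.Nonempty) : ∃ e ∈ R, pos π e = coverPos π R := by
  obtain ⟨e, he⟩ := hR
  exact Nat.sInf_mem (s := {i : ℕ | ∃ e ∈ R, pos π e = i}) ⟨_, e, he, rfl⟩

theorem coverPos_le_pos {U : Type*} [Fintype U] (π : Ranking U) {R : Finset U} {e : U}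
    (he : e ∈ R) : coverPos π R ≤ pos π e :=
  Nat.sInf_le ⟨e, he, rfl⟩

theorem coverPos_le_card {U : Type*} [Fintype U] (π : Ranking U) {R : Finset U}
    (hR : R.Nonempty) : coverPos π R ≤ Fintype.card U := by
  obtain ⟨e, he⟩ := hR
  exact (coverPos_le_pos π he).trans (π e).2

theorem one_le_coverPos {U : Type*} [Fintype U] (π : Ranking U) {R : Finset U}
    (hR : R.Nonempty) : 1 ≤ coverPos π R := by
  obtain ⟨e, _, he⟩ := exists_pos_eq_coverPos π hR
  rw [← he]; simp [pos]

/-- Along any schedule `σ` there is a schedule `τ` of permutations that always starts with a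
requested element and moves, in the footrule distance, by at most twice the cost of `σ`. -/
theorem exists_follows_schedule {U : Type*} [Fintype U] [DecidableEq U] {T : ℕ}
    {R : Fin T → Finset U} (hR : ∀ t, (R t).Nonempty) (σ : Fin (T + 1) → Ranking U) :
    ∃ τ : Fin (T + 1) → Ranking U, τ 0 = σ 0 ∧
      ∀ t : Fin T, (∃ e ∈ R t, (τ t.succ e : ℕ) = 0) ∧
        spearman (τ t.succ) (τ t.castSucc) ≤
          2 * ((coverPos (σ t.succ) (R t) : ℝ) + kendallTau (σ t.succ) (σ t.castSucc)) := by
  have step : ∀ t : Fin T, ∀ τ : {τ : Ranking U // Follows τ (σ t.castSucc)},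
      ∃ τ' : {τ : Ranking U // Follows τ (σ t.succ)}, (∃ e ∈ R t, (τ'.1 e : ℕ) = 0) ∧
        spearman τ'.1 τ.1 ≤
          2 * ((coverPos (σ t.succ) (R t) : ℝ) + kendallTau (σ t.succ) (σ t.castSucc)) := by
    rintro t ⟨τ, hτ⟩
    obtain ⟨τ₁, h1, h2⟩ := hτ.exists_follows (σ t.succ)
    obtain ⟨e, he, hpos⟩ := exists_pos_eq_coverPos (σ t.succ) (hR t)
    obtain ⟨τ₂, h3, h4, h5⟩ := h1.exists_front e
    refine ⟨⟨τ₂, h3⟩, ⟨e, he, h4⟩, ?_⟩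
    have h6 := spearman_triangle τ₂ τ₁ τ
    have h7 : ((τ₁ e : ℕ) : ℝ) ≤ coverPos (σ t.succ) (R t) := by
      rw [← hpos]; exact_mod_cast h1 e
    dsimp only
    linarith
  choose next h1 h2 using step
  let τ : ∀ t : Fin (T + 1), {τ : Ranking U // Follows τ (σ t)} :=
    Fin.induction ⟨σ 0, fun x => Nat.le_succ _⟩ next
  refine ⟨fun t => (τ t).1, rfl, fun t => ?_⟩
  have : τ t.succ = next t (τ t.castSucc) := Fin.induction_succ _ _ _
  dsimp only
  rw [this]
  exact ⟨h1 _ _, h2 _ _⟩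

/-- Doubly stochastic element-by-position matrices. -/
structure IsBistochastic {U : Type*} [Fintype U] (A : PosMatrix U) : Prop where
  nonneg : ∀ e i, 0 ≤ A e i
  row_sum : ∀ e, ∑ i, A e i = 1
  col_sum : ∀ i, ∑ e, A e i = 1

theorem isBistochastic_permMatrix {U : Type*} [Fintype U] (π : Ranking U) :
    IsBistochastic (permMatrix π) where
  nonneg e i := by unfold permMatrix; split_ifs <;> norm_num
  row_sum e := by simp [permMatrix]
  col_sum i := by
    classical
    have : ∀ e, permMatrix π e i = if e = π.symm i then 1 else 0 := fun e => by
      simp [permMatrix, Equiv.eq_symm_apply]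
    simp [this]

theorem isFracMTFFeasible_permMatrix {U : Type*} [Fintype U] {T : ℕ} {R : Fin T → Finset U}
    {π₀ : Ranking U} {τ : Fin (T + 1) → Ranking U} (h0 : τ 0 = π₀)
    (hτ : ∀ t : Fin T, ∃ e ∈ R t, (τ t.succ e : ℕ) = 0) :
    IsFracMTFFeasible R π₀ (fun t => permMatrix (τ t)) where
  init := by rw [h0]
  nonneg t := (isBistochastic_permMatrix (τ t.succ)).nonneg
  row_sum t := (isBistochastic_permMatrix (τ t.succ)).row_sum
  col_sum t := (isBistochastic_permMatrix (τ t.succ)).col_sum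
  first_col t i hi := by
    obtain ⟨e, he, h⟩ := hτ t
    have hei : τ t.succ e = i := Fin.ext (h.trans hi.symm)
    classical
    have : ∀ x, permMatrix (τ t.succ) x i = if x = e then 1 else 0 := fun x => by
      simp [permMatrix, ← hei]
    simp [this, he]

/-- Fractional-MTF is bounded by twice the cost of any schedule. -/
theorem fracMTFCost_le_two_mul_totalCost {U : Type*} [Fintype U] {T : ℕ} {R : Fin T → Finset U}
    {π₀ : Ranking U} {A : Fin (T + 1) → PosMatrix U} (hR : ∀ t, (R t).Nonempty)
    (hA : IsFracMTFOptimal R π₀ A) {σ : Fin (T + 1) → Ranking U} (hσ : σ 0 = π₀) :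
    fracMTFCost A ≤ 2 * (totalCost R σ : ℝ) := by
  classical
  obtain ⟨τ, h0, hτ⟩ := exists_follows_schedule hR σ
  refine (hA.2 _ (isFracMTFFeasible_permMatrix (h0.trans hσ) fun t => (hτ t).1)).trans ?_
  simp only [fracMTFCost, totalCost, coveringCost, movingCost, Nat.cast_add, Nat.cast_sum]
  rw [← Finset.sum_add_distrib, Finset.mul_sum]
  exact Finset.sum_le_sum fun t _ => (footrule_permMatrix_le _ _).trans (hτ t).2

theorem exists_isOptimalSolution {U : Type*} [Fintype U] {T : ℕ} (R : Fin T → Finset U)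
    (π₀ : Ranking U) : ∃ σ : Fin (T + 1) → Ranking U, IsOptimalSolution R π₀ σ :=
  Nat.sInf_mem (s := {c : ℕ | ∃ σ : Fin (T + 1) → Ranking U, σ 0 = π₀ ∧ totalCost R σ = c})
    ⟨_, fun _ => π₀, rfl, rfl⟩

theorem le_coveringCost {U : Type*} [Fintype U] {T : ℕ} {R : Fin T → Finset U}
    (hR : ∀ t, (R t).Nonempty) (σ : Fin (T + 1) → Ranking U) : T ≤ coveringCost R σ := by
  have := Finset.sum_le_sum fun (t : Fin T) (_ : t ∈ Finset.univ) =>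
    one_le_coverPos (σ t.succ) (hR t)
  simpa [coveringCost] using this

/-! ### Indices as thresholds on prefix masses -/

theorem IsFracMTFFeasible.isBistochastic {U : Type*} [Fintype U] {T : ℕ} {R : Fin T → Finset U}
    {π₀ : Ranking U} {A : Fin (T + 1) → PosMatrix U} (hA : IsFracMTFFeasible R π₀ A)
    (t : Fin (T + 1)) : IsBistochastic (A t) := by
  refine Fin.cases ?_ (fun t => ?_) t
  · rw [hA.init]; exact isBistochastic_permMatrix π₀
  · exact ⟨hA.nonneg t, hA.row_sum t, hA.col_sum t⟩

section Prefix

variable {U : Type*} [Fintype U] {A : PosMatrix U}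

@[simp] theorem prefixMass_zero (A : PosMatrix U) (e : U) : prefixMass A e 0 = 0 := by
  simp [prefixMass]

theorem prefixMass_mono (hA : IsBistochastic A) (e : U) : Monotone (prefixMass A e) := by
  intro k l hkl
  refine Finset.sum_le_sum fun s _ => ?_
  have := hA.nonneg e s
  split_ifs <;> first | omega | exact le_rfl

theorem prefixMass_of_card_le (hA : IsBistochastic A) (e : U) {k : ℕ}
    (hk : Fintype.card U ≤ k) : prefixMass A e k = 1 := by
  rw [← hA.row_sum e]
  exact Finset.sum_congr rfl fun s _ => if_pos (s.2.trans_le hk)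

theorem prefixMass_succ (A : PosMatrix U) (e : U) {k : ℕ} (hk : k < Fintype.card U) :
    prefixMass A e (k + 1) = prefixMass A e k + A e ⟨k, hk⟩ := by
  have : A e ⟨k, hk⟩ = ∑ s : Fin (Fintype.card U), if s = ⟨k, hk⟩ then A e s else 0 := by simp
  rw [prefixMass, prefixMass, this, ← Finset.sum_add_distrib]
  refine Finset.sum_congr rfl fun s _ => ?_
  simp only [Fin.ext_iff]
  split_ifs <;> first | omega | simp

theorem sum_prefixMass_succ_sub_le (hA : IsBistochastic A) (k : ℕ) :
    ∑ e, (prefixMass A e (k + 1) - prefixMass A e k) ≤ 1 := by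
  rcases lt_or_ge k (Fintype.card U) with hk | hk
  · simp only [prefixMass_succ A _ hk, add_sub_cancel_left]
    exact (hA.col_sum _).le
  · simp [prefixMass_of_card_le hA _ hk, prefixMass_of_card_le hA _ (hk.trans k.le_succ)]

/-- Any two consecutive columns together carry mass at most two. -/
theorem sum_prefixMass_add_two_sub_le (hA : IsBistochastic A) (k : ℕ) :
    ∑ e, (prefixMass A e (k + 2) - prefixMass A e k) ≤ 2 := by
  have h1 := sum_prefixMass_succ_sub_le hA k
  have h2 := sum_prefixMass_succ_sub_le hA (k + 1)
  rw [Finset.sum_sub_distrib] at *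
  linarith

theorem sum_Iic_eq_prefixMass (A : PosMatrix U) (e : U) {i : ℕ} (h : i < Fintype.card U) :
    ∑ s ∈ Finset.Iic (⟨i, h⟩ : Fin (Fintype.card U)), A e s = prefixMass A e (i + 1) := by
  rw [prefixMass, ← Finset.sum_filter]
  congr 1
  ext s
  simp [Fin.le_def]

theorem roundIndex_lt_card (A : PosMatrix U) (α : U → ℝ) (e : U) :
    roundIndex A α e < Fintype.card U := by
  have hn : 0 < Fintype.card U := Fintype.card_pos_iff.2 ⟨e⟩
  have : roundIndex A α e ≤ Fintype.card U - 1 := Nat.sInf_le (Or.inl (by omega))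
  omega

/-- For at least three elements the last column is no exception: the condition on the thresholds
has the same form at every place. -/
theorem roundIndex_lt_iff (hA : IsBistochastic A) (hL : 1 ≤ Real.log (Fintype.card U))
    {α : U → ℝ} {e : U} (hα : α e ∈ Set.Ioc (0 : ℝ) 1) (k : ℕ) :
    roundIndex A α e < k ↔ α e ≤ Real.log (Fintype.card U) * prefixMass A e k := by
  have hn : 0 < Fintype.card U := Fintype.card_pos_iff.2 ⟨e⟩
  have hcard : ∀ {k}, Fintype.card U ≤ k →
      α e ≤ Real.log (Fintype.card U) * prefixMass A e k := fun hk => by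
    rw [prefixMass_of_card_le hA e hk, mul_one]; exact hα.2.trans hL
  constructor
  · intro h
    have hmem : roundIndex A α e ∈ {i : ℕ | i + 1 = Fintype.card U ∨ ∃ h : i < Fintype.card U,
        α e ≤ Real.log (Fintype.card U) *
          ∑ s ∈ Finset.Iic (⟨i, h⟩ : Fin (Fintype.card U)), A e s} :=
      Nat.sInf_mem ⟨Fintype.card U - 1, Or.inl (by omega)⟩
    rcases hmem with h1 | ⟨h1, h2⟩
    · exact hcard (by omega)
    · rw [sum_Iic_eq_prefixMass] at h2
      exact h2.trans (mul_le_mul_of_nonneg_left (prefixMass_mono hA e h) (by linarith))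
  · intro h
    rcases k with _ | k
    · rw [prefixMass_zero, mul_zero] at h; exact absurd h hα.1.not_ge
    rcases lt_or_ge k (Fintype.card U) with hk | hk
    · exact Nat.lt_succ_of_le (Nat.sInf_le (Or.inr ⟨hk, by rwa [sum_Iic_eq_prefixMass]⟩))
    · exact (roundIndex_lt_card A α e).trans_le (hk.trans k.le_succ)

theorem prefixMass_permMatrix (π : Ranking U) (e : U) (k : ℕ) :
    prefixMass (permMatrix π) e k = if (π e : ℕ) < k then 1 else 0 := by
  unfold prefixMass permMatrix
  rw [Finset.sum_eq_single (π e)]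
  · simp
  · intro b _ hb; simp [hb.symm]
  · simp

theorem sortRanking_lt_iff [LinearOrder U] (I : U → ℕ) (e f : U) :
    sortRanking I e < sortRanking I f ↔ I e < I f ∨ (I e = I f ∧ e < f) := by
  refine ⟨fun h => ?_, fun h => sortRank_lt_sortRank I h⟩
  by_contra hcon
  have hfe : I f < I e ∨ (I f = I e ∧ f ≤ e) := by
    rcases lt_trichotomy (I e) (I f) with h1 | h1 | h1
    · exact absurd (Or.inl h1) hcon
    · exact Or.inr ⟨h1.symm, not_lt.1 fun h2 => hcon (Or.inr ⟨h1, h2⟩)⟩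
    · exact Or.inl h1
  rcases hfe with h1 | ⟨h1, h2⟩
  · exact absurd h (lt_asymm (sortRank_lt_sortRank I (Or.inl h1) :
      sortRanking I f < sortRanking I e))
  · rcases h2.lt_or_eq with h2 | rfl
    · exact absurd h (lt_asymm (sortRank_lt_sortRank I (Or.inr ⟨h1, h2⟩) :
        sortRanking I f < sortRanking I e))
    · exact lt_irrefl _ h

/-- Rounding the matrix of a permutation returns the permutation. -/
theorem sortRanking_roundIndex_permMatrix [LinearOrder U] (π : Ranking U)
    (hL : 1 ≤ Real.log (Fintype.card U)) {α : U → ℝ} (hα : ∀ e, α e ∈ Set.Ioc (0 : ℝ) 1) :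
    sortRanking (roundIndex (permMatrix π) α) = π := by
  have hI : ∀ e, roundIndex (permMatrix π) α e = π e := fun e => by
    have key : ∀ k, roundIndex (permMatrix π) α e < k ↔ (π e : ℕ) < k := fun k => by
      rw [roundIndex_lt_iff (isBistochastic_permMatrix π) hL (hα e), prefixMass_permMatrix]
      split_ifs with h
      · simpa [h] using (hα e).2.trans hL
      · simpa [h] using (hα e).1
    have h1 := key (roundIndex (permMatrix π) α e)
    have h2 := key (π e)
    omega
  by_contra hne
  obtain ⟨x, y, hxy, hyx⟩ := exists_adjacent_inversion hne
  rw [sortRanking_lt_iff, hI, hI] at hyx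
  omega

end Prefix

/-! ### The thresholds -/

section Law

variable {U : Type*} [Fintype U]

/-- The uniform distribution on `[0, 1]`. -/
noncomputable def unitLaw : Measure ℝ := (volume : Measure ℝ).restrict (Set.Icc 0 1)

instance : IsProbabilityMeasure unitLaw := ⟨by simp [unitLaw]⟩

instance : IsProbabilityMeasure (thresholdLaw U) :=
  inferInstanceAs (IsProbabilityMeasure (Measure.pi fun _ : U => unitLaw))

theorem unitLaw_real_Ioc_le (a b : ℝ) : unitLaw.real (Set.Ioc a b) ≤ max (b - a) 0 := by
  have h : unitLaw (Set.Ioc a b) ≤ ENNReal.ofReal (b - a) := by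
    rw [← Real.volume_Ioc]; exact Measure.restrict_apply_le _ _
  have := ENNReal.toReal_mono ENNReal.ofReal_ne_top h
  rwa [ENNReal.toReal_ofReal'] at this

theorem unitLaw_real_Ioi_le (c : ℝ) : unitLaw.real (Set.Ioi c) ≤ Real.exp (-c) := by
  have h : unitLaw (Set.Ioi c) ≤ ENNReal.ofReal (1 - c) := by
    rw [← Real.volume_Ioc, unitLaw, Measure.restrict_apply measurableSet_Ioi]
    exact measure_mono fun x hx => ⟨hx.1, hx.2.2⟩
  have h1 := ENNReal.toReal_mono ENNReal.ofReal_ne_top h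
  rw [ENNReal.toReal_ofReal'] at h1
  refine h1.trans (max_le ?_ (Real.exp_pos _).le)
  linarith [Real.add_one_le_exp (-c)]

theorem thresholdLaw_real_pi [DecidableEq U] (S : Finset U) (s : U → Set ℝ) :
    (thresholdLaw U).real {α | ∀ e ∈ S, α e ∈ s e} = ∏ e ∈ S, unitLaw.real (s e) := by
  have h : {α : U → ℝ | ∀ e ∈ S, α e ∈ s e} =
      Set.univ.pi fun e => if e ∈ S then s e else Set.univ := by
    ext α
    simp only [Set.mem_ofPred_eq, Set.mem_univ_pi]
    refine forall_congr' fun e => ?_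
    by_cases he : e ∈ S <;> simp [he]
  have h2 : thresholdLaw U (Set.univ.pi fun e => if e ∈ S then s e else Set.univ) =
      ∏ e, unitLaw (if e ∈ S then s e else Set.univ) := Measure.pi_pi _ _
  rw [h, Measure.real, h2, ENNReal.toReal_prod,
    ← Finset.prod_subset (Finset.subset_univ S) fun e _ he => by simp [he]]
  exact Finset.prod_congr rfl fun e he => by simp [he, Measure.real]

theorem thresholdLaw_real_pair {e f : U} (hef : e ≠ f) (s t : Set ℝ) :
    (thresholdLaw U).real {α | α e ∈ s ∧ α f ∈ t} = unitLaw.real s * unitLaw.real t := by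
  classical
  have := thresholdLaw_real_pi {e, f} (fun g => if g = e then s else t)
  rw [Finset.prod_pair hef] at this
  simpa [hef.symm] using this

theorem ae_mem_Ioc : ∀ᵐ α ∂(thresholdLaw U), ∀ e, α e ∈ Set.Ioc (0 : ℝ) 1 := by
  rw [ae_all_iff]
  intro e
  have h1 : ∀ᵐ x ∂unitLaw, x ∈ Set.Ioc (0 : ℝ) 1 := by
    rw [unitLaw, ← restrict_Ioc_eq_restrict_Icc]
    exact ae_restrict_mem measurableSet_Ioc
  exact (measurePreserving_eval (fun _ : U => unitLaw) e).quasiMeasurePreserving.ae h1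

/-- The indices depend on the thresholds through finitely many comparisons, so every function of
them that takes values in a bounded set of natural numbers is integrable. -/
theorem integrable_comp_roundIndex {ι : Type*} [Finite ι] (A : ι → PosMatrix U)
    (g : (ι → U → ℕ) → ℕ) {N : ℕ} (hg : ∀ I, g I ≤ N) :
    Integrable (fun α => (g (fun t => roundIndex (A t) α) : ℝ)) (thresholdLaw U) := by
  have h1 : ∀ t e, Measurable fun α : U → ℝ => roundIndex (A t) α e := by
    intro t e
    let F : (Fin (Fintype.card U) → Prop) → ℕ := fun P =>
      sInf {i : ℕ | i + 1 = Fintype.card U ∨ ∃ h : i < Fintype.card U, P ⟨i, h⟩}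
    have h2 : Measurable fun α : U → ℝ => fun i : Fin (Fintype.card U) =>
        α e ≤ Real.log (Fintype.card U) * ∑ s ∈ Finset.Iic i, A t e s := by
      refine measurable_pi_iff.2 fun i => ?_
      exact measurableSet_setOfPred.1 (measurableSet_le (measurable_pi_apply e) measurable_const)
    exact (Measurable.of_discrete (f := F)).comp h2
  have h2 : Measurable fun α : U → ℝ => fun (t : ι) (e : U) => roundIndex (A t) α e :=
    measurable_pi_iff.2 fun t => measurable_pi_iff.2 fun e => h1 t e
  have h3 : Measurable fun α : U → ℝ => (g (fun t => roundIndex (A t) α) : ℝ) :=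
    (Measurable.of_discrete (f := fun I : ι → U → ℕ => (g I : ℝ))).comp h2
  refine Integrable.of_bound h3.aestronglyMeasurable N (Filter.Eventually.of_forall fun α => ?_)
  rw [Real.norm_of_nonneg (Nat.cast_nonneg _)]
  exact_mod_cast hg _

end Law

/-! ### The moving cost of one round -/

section Moving

variable {U : Type*} [Fintype U]

/-- In every inversion one of the two elements moves away from the other one and jumps over the
gap between the places `k` and `k + 1`, and the other one is at an end of this gap: `e` moves
backwards over the old place of `f`, or `f` moves forwards over the new place of `e`. -/
theorem exists_crossing [LinearOrder U] {I J : U → ℕ} {e f : U}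
    (h1 : sortRanking I e < sortRanking I f) (h2 : sortRanking J f < sortRanking J e) :
    (∃ k, (I e ≤ k ∧ k < J e) ∧ k ≤ I f ∧ I f < k + 2) ∨
      (∃ k, (J f ≤ k ∧ k < I f) ∧ k ≤ J e ∧ J e < k + 2) := by
  rw [sortRanking_lt_iff] at h1 h2
  have htie : ¬ (e < f ∧ f < e) := fun h => lt_asymm h.1 h.2
  rcases lt_or_ge (J e) (I f) with h3 | h3
  · exact Or.inr ⟨J e, by omega⟩
  rcases lt_or_ge (I e) (J e) with h4 | h4
  · left
    rcases lt_or_ge (I f) (J e) with h5 | h5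
    · exact ⟨I f, by omega⟩
    · exact ⟨I f - 1, by omega⟩
  · have h5 : J f < I f := by
      by_contra h6
      apply htie
      constructor
      · rcases h1 with h1 | h1
        · omega
        · exact h1.2
      · rcases h2 with h2 | h2
        · omega
        · exact h2.2
    exact Or.inr ⟨I f - 1, by omega⟩

/-- The threshold of `e` sends `e` from a place up to `k` for `A` to a later one for `B`, while the
index of `f` for `A` is `k` or `k + 1`. -/
def crossing (A B : PosMatrix U) (e f : U) (k : ℕ) : Set (U → ℝ) :=
  {α | α e ∈ Set.Ioc (Real.log (Fintype.card U) * prefixMass B e (k + 1))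
      (Real.log (Fintype.card U) * prefixMass A e (k + 1)) ∧
    α f ∈ Set.Ioc (Real.log (Fintype.card U) * prefixMass A f k)
      (Real.log (Fintype.card U) * prefixMass A f (k + 2))}

theorem measurableSet_crossing (A B : PosMatrix U) (e f : U) (k : ℕ) :
    MeasurableSet (crossing A B e f k) :=
  (measurable_pi_apply e measurableSet_Ioc).inter (measurable_pi_apply f measurableSet_Ioc)

theorem mem_crossing {A B : PosMatrix U} (hA : IsBistochastic A) (hB : IsBistochastic B)
    (hL : 1 ≤ Real.log (Fintype.card U)) {α : U → ℝ} (hα : ∀ e, α e ∈ Set.Ioc (0 : ℝ) 1)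
    {e f : U} {k : ℕ} :
    α ∈ crossing A B e f k ↔ (roundIndex A α e ≤ k ∧ k < roundIndex B α e) ∧
      k ≤ roundIndex A α f ∧ roundIndex A α f < k + 2 := by
  have h1 := roundIndex_lt_iff hA hL (hα e) (k + 1)
  have h2 := roundIndex_lt_iff hB hL (hα e) (k + 1)
  have h3 := roundIndex_lt_iff hA hL (hα f) k
  have h4 := roundIndex_lt_iff hA hL (hα f) (k + 2)
  simp only [crossing, Set.mem_ofPred_eq, Set.mem_Ioc, ← not_le, ← h1, ← h2, ← h3, ← h4]
  omega

theorem thresholdLaw_real_crossing_le {A : PosMatrix U} (hA : IsBistochastic A) (B : PosMatrix U)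
    {e f : U} (hef : e ≠ f) (k : ℕ) :
    (thresholdLaw U).real (crossing A B e f k) ≤
      Real.log (Fintype.card U) ^ 2 * (max (prefixMass A e (k + 1) - prefixMass B e (k + 1)) 0 *
        (prefixMass A f (k + 2) - prefixMass A f k)) := by
  have hL : 0 ≤ Real.log (Fintype.card U) := Real.log_natCast_nonneg _
  have hm := sub_nonneg.2 (prefixMass_mono hA f (show k ≤ k + 2 by omega))
  rw [crossing, thresholdLaw_real_pair hef]
  have h1 := unitLaw_real_Ioc_le (Real.log (Fintype.card U) * prefixMass B e (k + 1))
    (Real.log (Fintype.card U) * prefixMass A e (k + 1))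
  have h2 := unitLaw_real_Ioc_le (Real.log (Fintype.card U) * prefixMass A f k)
    (Real.log (Fintype.card U) * prefixMass A f (k + 2))
  rw [← mul_sub, ← mul_zero (Real.log _), ← mul_max_of_nonneg _ _ hL] at h1 h2
  rw [max_eq_left hm] at h2
  refine (mul_le_mul h1 h2 measureReal_nonneg (by positivity)).trans (le_of_eq ?_)
  ring

/-- Summation over `f` first: at most `2 * log n` elements `f` are expected at the two ends of the
gap that `e` crosses. -/
theorem sum_crossing_le [DecidableEq U] {A : PosMatrix U} (hA : IsBistochastic A)
    (B : PosMatrix U) :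
    ∑ p ∈ (Finset.univ : Finset U).offDiag, ∑ k ∈ Finset.range (Fintype.card U),
        (thresholdLaw U).real (crossing A B p.1 p.2 k) ≤
      2 * Real.log (Fintype.card U) ^ 2 * ∑ e, ∑ k ∈ Finset.range (Fintype.card U),
        max (prefixMass A e (k + 1) - prefixMass B e (k + 1)) 0 := by
  set L := Real.log (Fintype.card U)
  let Φ : U × U → ℝ := fun p => ∑ k ∈ Finset.range (Fintype.card U),
    L ^ 2 * (max (prefixMass A p.1 (k + 1) - prefixMass B p.1 (k + 1)) 0 *
      (prefixMass A p.2 (k + 2) - prefixMass A p.2 k))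
  have hm : ∀ f k, 0 ≤ prefixMass A f (k + 2) - prefixMass A f k := fun f k =>
    sub_nonneg.2 (prefixMass_mono hA f (show k ≤ k + 2 by omega))
  have hΦ : ∀ p, 0 ≤ Φ p := fun p => Finset.sum_nonneg fun k _ =>
    mul_nonneg (sq_nonneg _) (mul_nonneg (le_max_right _ _) (hm _ _))
  calc _ ≤ ∑ p ∈ (Finset.univ : Finset U).offDiag, Φ p :=
        Finset.sum_le_sum fun p hp => Finset.sum_le_sum fun k _ =>
          thresholdLaw_real_crossing_le hA B (Finset.mem_offDiag.1 hp).2.2 k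
    _ ≤ ∑ p : U × U, Φ p := Finset.sum_le_sum_of_subset_of_nonneg (Finset.subset_univ _)
        fun p _ _ => hΦ p
    _ = ∑ e, ∑ f, Φ (e, f) := Fintype.sum_prod_type _
    _ ≤ _ := by
      rw [Finset.mul_sum]
      refine Finset.sum_le_sum fun e _ => ?_
      rw [Finset.sum_comm, Finset.mul_sum]
      refine Finset.sum_le_sum fun k _ => ?_
      dsimp only
      rw [← Finset.mul_sum, ← Finset.mul_sum]
      have h := mul_le_mul_of_nonneg_left (sum_prefixMass_add_two_sub_le hA k)
        (mul_nonneg (sq_nonneg L)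
          (le_max_right (prefixMass A e (k + 1) - prefixMass B e (k + 1)) 0))
      linarith

theorem kendallTau_le (π σ : Ranking U) : kendallTau π σ ≤ Fintype.card U * Fintype.card U := by
  rw [← Fintype.card_prod]
  exact Finset.card_le_univ _

theorem kendallTau_le_one (hn : Fintype.card U ≤ 2) (π σ : Ranking U) : kendallTau π σ ≤ 1 := by
  refine Finset.card_le_one.2 ?_
  rintro ⟨a, b⟩ h ⟨c, d⟩ h'
  simp only [Finset.mem_filter, Finset.mem_univ, true_and] at h h'
  simp only [pos] at h h'
  have h1 := (π a).2
  have h2 := (π c).2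
  have hac : π a = π c := Fin.ext (by omega)
  have hbd : π b = π d := Fin.ext (by omega)
  rw [π.injective hac, π.injective hbd]

theorem kendallTau_eq_zero (hn : Fintype.card U ≤ 1) (π σ : Ranking U) : kendallTau π σ = 0 := by
  refine Finset.card_eq_zero.2 (Finset.filter_eq_empty_iff.2 ?_)
  rintro ⟨a, b⟩ _ h
  simp only [pos] at h
  have h1 := (π a).2
  omega

/-- The expected number of inversions between two rounds is at most `2 log² n` times the footrule
distance of the two matrices. -/
theorem integral_kendallTau_le [LinearOrder U] {A B : PosMatrix U} (hA : IsBistochastic A)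
    (hB : IsBistochastic B) (hL : 1 ≤ Real.log (Fintype.card U)) :
    ∫ α, (kendallTau (sortRanking (roundIndex B α)) (sortRanking (roundIndex A α)) : ℝ)
        ∂(thresholdLaw U) ≤
      2 * Real.log (Fintype.card U) ^ 2 * footrule B A := by
  let ind : Set (U → ℝ) → (U → ℝ) → ℝ := fun S => S.indicator 1
  have hint : ∀ C D e f k, Integrable (ind (crossing C D e f k)) (thresholdLaw U) :=
    fun C D e f k => (integrable_const (1 : ℝ)).indicator (measurableSet_crossing C D e f k)
  have hval : ∀ C D e f k, ∫ α, ind (crossing C D e f k) α ∂(thresholdLaw U) =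
      (thresholdLaw U).real (crossing C D e f k) :=
    fun C D e f k => integral_indicator_one (measurableSet_crossing C D e f k)
  have hind : ∀ S α, 0 ≤ ind S α := fun S α => Set.indicator_nonneg (fun _ _ => zero_le_one) α
  have hkt : Integrable (fun α => (kendallTau (sortRanking (roundIndex B α))
      (sortRanking (roundIndex A α)) : ℝ)) (thresholdLaw U) :=
    integrable_comp_roundIndex (fun b : Bool => if b then B else A)
      (fun I => kendallTau (sortRanking (I true)) (sortRanking (I false)))
      (fun I => kendallTau_le _ _)
  have hpt : ∀ᵐ α ∂(thresholdLaw U),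
      (kendallTau (sortRanking (roundIndex B α)) (sortRanking (roundIndex A α)) : ℝ) ≤
        ∑ p ∈ (Finset.univ : Finset U).offDiag, ∑ k ∈ Finset.range (Fintype.card U),
          (ind (crossing A B p.1 p.2 k) α + ind (crossing B A p.2 p.1 k) α) := by
    filter_upwards [ae_mem_Ioc] with α hα
    unfold kendallTau
    rw [← nsmul_one, ← Finset.sum_const]
    refine (Finset.sum_le_sum (g := fun p : U × U => ∑ k ∈ Finset.range (Fintype.card U),
      (ind (crossing A B p.1 p.2 k) α + ind (crossing B A p.2 p.1 k) α)) ?_).trans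
        (Finset.sum_le_sum_of_subset_of_nonneg ?_ fun p _ _ =>
          Finset.sum_nonneg fun k _ => add_nonneg (hind _ _) (hind _ _))
    · rintro ⟨e, f⟩ hef
      simp only [Finset.mem_filter, Finset.mem_univ, true_and] at hef
      simp only [pos] at hef
      have hone : ∀ k, k < Fintype.card U →
          (α ∈ crossing A B e f k ∨ α ∈ crossing B A f e k) →
          1 ≤ ∑ k ∈ Finset.range (Fintype.card U),
            (ind (crossing A B e f k) α + ind (crossing B A f e k) α) := by
        intro k hk hmem
        refine le_trans ?_ (Finset.single_le_sum
          (f := fun k => ind (crossing A B e f k) α + ind (crossing B A f e k) α)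
          (fun k _ => add_nonneg (hind _ _) (hind _ _)) (Finset.mem_range.2 hk))
        rcases hmem with h | h
        · have h1 : ind (crossing A B e f k) α = 1 := Set.indicator_of_mem h _
          have h2 := hind (crossing B A f e k) α
          linarith
        · have h1 : ind (crossing B A f e k) α = 1 := Set.indicator_of_mem h _
          have h2 := hind (crossing A B e f k) α
          linarith
      rcases exists_crossing (I := roundIndex A α) (J := roundIndex B α) (e := e) (f := f)
        (Fin.lt_def.2 (by omega)) (Fin.lt_def.2 (by omega)) with ⟨k, hk⟩ | ⟨k, hk⟩
      · exact hone k (hk.1.2.trans (roundIndex_lt_card B α e))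
          (Or.inl ((mem_crossing hA hB hL hα).2 hk))
      · exact hone k (hk.1.2.trans (roundIndex_lt_card A α f))
          (Or.inr ((mem_crossing hB hA hL hα).2 hk))
    · intro p hp
      simp only [Finset.mem_filter, Finset.mem_univ, true_and] at hp
      refine Finset.mem_offDiag.2 ⟨Finset.mem_univ _, Finset.mem_univ _, fun h => ?_⟩
      rw [h] at hp
      exact lt_irrefl _ hp.1
  have hintk : ∀ p : U × U, ∀ k ∈ Finset.range (Fintype.card U), Integrable (fun α =>
      ind (crossing A B p.1 p.2 k) α + ind (crossing B A p.2 p.1 k) α) (thresholdLaw U) :=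
    fun p k _ => (hint _ _ _ _ _).add (hint _ _ _ _ _)
  have hintp := fun p : U × U => integrable_finsetSum _ (hintk p)
  refine (integral_mono_ae hkt (integrable_finsetSum _ fun p _ => hintp p) hpt).trans ?_
  rw [integral_finsetSum _ fun p _ => hintp p]
  have hsum : ∀ p : U × U, ∫ α, ∑ k ∈ Finset.range (Fintype.card U),
      (ind (crossing A B p.1 p.2 k) α + ind (crossing B A p.2 p.1 k) α) ∂(thresholdLaw U) =
      ∑ k ∈ Finset.range (Fintype.card U), (thresholdLaw U).real (crossing A B p.1 p.2 k) +
      ∑ k ∈ Finset.range (Fintype.card U), (thresholdLaw U).real (crossing B A p.2 p.1 k) := by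
    intro p
    rw [integral_finsetSum _ (hintk p), ← Finset.sum_add_distrib]
    refine Finset.sum_congr rfl fun k _ => ?_
    rw [integral_add (hint _ _ _ _ _) (hint _ _ _ _ _), hval, hval]
  simp only [hsum]
  rw [Finset.sum_add_distrib]
  have hswap : ∑ p ∈ (Finset.univ : Finset U).offDiag, ∑ k ∈ Finset.range (Fintype.card U),
      (thresholdLaw U).real (crossing B A p.2 p.1 k) =
      ∑ p ∈ (Finset.univ : Finset U).offDiag, ∑ k ∈ Finset.range (Fintype.card U),
        (thresholdLaw U).real (crossing B A p.1 p.2 k) :=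
    Finset.sum_nbij' Prod.swap Prod.swap (by simp [eq_comm]) (by simp [eq_comm]) (by simp)
      (by simp) (by simp)
  rw [hswap]
  have h1 := sum_crossing_le hA B
  have h2 := sum_crossing_le hB A
  have h3 := sum_prefixMass_sub_le_footrule hB.nonneg hB.row_sum hA.nonneg hA.row_sum
  have h4 : ∑ e, ∑ k ∈ Finset.range (Fintype.card U),
        max (prefixMass A e (k + 1) - prefixMass B e (k + 1)) 0 +
      ∑ e, ∑ k ∈ Finset.range (Fintype.card U),
        max (prefixMass B e (k + 1) - prefixMass A e (k + 1)) 0 =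
      ∑ e, ∑ k ∈ Finset.range (Fintype.card U),
        |prefixMass B e (k + 1) - prefixMass A e (k + 1)| := by
    simp only [← Finset.sum_add_distrib]
    refine Finset.sum_congr rfl fun e _ => Finset.sum_congr rfl fun k _ => ?_
    rcases le_total (prefixMass A e (k + 1)) (prefixMass B e (k + 1)) with h | h
    · rw [max_eq_right (by linarith), max_eq_left (by linarith), abs_of_nonneg (by linarith)]
      ring
    · rw [max_eq_left (by linarith), max_eq_right (by linarith), abs_of_nonpos (by linarith)]
      ring
  rw [← h4] at h3
  have h5 := mul_le_mul_of_nonneg_left h3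
    (show 0 ≤ 2 * Real.log (Fintype.card U) ^ 2 by positivity)
  linarith

end Moving

/-! ### The covering cost of one round -/

/-- If an element of `R` is placed in the first column, then so is the front of the permutation;
as the first column is carried by `R`, the front belongs to `R`. Otherwise, which has probability
at most `exp (-log n) = 1 / n`, the covering cost is at most `n`. -/
theorem integral_coverPos_le {U : Type*} [Fintype U] [LinearOrder U] {A : PosMatrix U}
    (hA : IsBistochastic A) (hL : 1 ≤ Real.log (Fintype.card U)) {R : Finset U} (hR : R.Nonempty)
    (hR1 : ∀ i : Fin (Fintype.card U), (i : ℕ) = 0 → ∑ e ∈ R, A e i = 1) :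
    ∫ α, (coverPos (sortRanking (roundIndex A α)) R : ℝ) ∂(thresholdLaw U) ≤ 2 := by
  obtain ⟨e₀, he₀⟩ := hR
  have hn : 0 < Fintype.card U := Fintype.card_pos_iff.2 ⟨e₀⟩
  set n := Fintype.card U with hndef
  have hn' : (0 : ℝ) < n := by exact_mod_cast hn
  have hcol : ∀ e, prefixMass A e 1 = A e ⟨0, hn⟩ := fun e => by
    have := prefixMass_succ A e hn
    simpa using this
  -- no element of `R` has index `0`
  let bad : Set (U → ℝ) := {α | ∀ e ∈ R, α e ∈ Set.Ioi (Real.log n * prefixMass A e 1)}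
  have hbadm : MeasurableSet bad := by
    have : bad = ⋂ e ∈ R, (fun α : U → ℝ => α e) ⁻¹' Set.Ioi (Real.log n * prefixMass A e 1) := by
      ext α; simp [bad]
    rw [this]
    exact R.measurableSet_biInter fun e _ => measurable_pi_apply e measurableSet_Ioi
  have hbad : (thresholdLaw U).real bad ≤ 1 / n := by
    rw [thresholdLaw_real_pi]
    refine (Finset.prod_le_prod (fun _ _ => measureReal_nonneg)
      fun e _ => unitLaw_real_Ioi_le _).trans (le_of_eq ?_)
    rw [← Real.exp_sum, Finset.sum_neg_distrib, ← Finset.mul_sum, Finset.sum_congr rfl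
      fun e _ => hcol e, hR1 _ rfl, mul_one, Real.exp_neg, Real.exp_log hn', one_div]
  have hpt : ∀ᵐ α ∂(thresholdLaw U), (coverPos (sortRanking (roundIndex A α)) R : ℝ) ≤
      1 + bad.indicator (fun _ => (n : ℝ)) α := by
    filter_upwards [ae_mem_Ioc] with α hα
    by_cases h : α ∈ bad
    · rw [Set.indicator_of_mem h]
      have : (coverPos (sortRanking (roundIndex A α)) R : ℝ) ≤ n := by
        exact_mod_cast coverPos_le_card _ ⟨e₀, he₀⟩
      linarith
    · rw [Set.indicator_of_notMem h, add_zero]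
      obtain ⟨e, he, hle⟩ : ∃ e ∈ R, α e ≤ Real.log n * prefixMass A e 1 := by
        by_contra! hcon
        exact h hcon
      have hIe := (roundIndex_lt_iff hA hL (hα e) 1).2 hle
      obtain ⟨f, hf⟩ : ∃ f, (sortRanking (roundIndex A α) f : ℕ) = 0 :=
        ⟨(sortRanking (roundIndex A α)).symm ⟨0, hn⟩, by simp⟩
      have hIf : roundIndex A α f < 1 := by
        by_contra! hcon
        have := (sortRanking_lt_iff (roundIndex A α) e f).2 (Or.inl (by omega))
        rw [Fin.lt_def] at this
        omega
      have hfR : f ∈ R := by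
        by_contra hfR
        have hzero : A f ⟨0, hn⟩ = 0 := by
          have h1 := Finset.sum_le_sum_of_subset_of_nonneg (Finset.subset_univ (insert f R))
            fun x _ _ => hA.nonneg x ⟨0, hn⟩
          rw [Finset.sum_insert hfR, hR1 _ rfl, hA.col_sum] at h1
          exact le_antisymm (by linarith) (hA.nonneg _ _)
        have h2 := (roundIndex_lt_iff hA hL (hα f) 1).1 hIf
        rw [hcol, hzero, mul_zero] at h2
        exact absurd h2 (hα f).1.not_ge
      have := coverPos_le_pos (sortRanking (roundIndex A α)) hfR
      rw [pos, hf] at this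
      exact_mod_cast this
  have hind : Integrable (bad.indicator fun _ => (n : ℝ)) (thresholdLaw U) :=
    (integrable_const _).indicator hbadm
  have hcov : Integrable (fun α => (coverPos (sortRanking (roundIndex A α)) R : ℝ))
      (thresholdLaw U) :=
    integrable_comp_roundIndex (fun _ : Unit => A) (fun I => coverPos (sortRanking (I ())) R)
      fun I => coverPos_le_card _ ⟨e₀, he₀⟩
  refine (integral_mono_ae hcov ((integrable_const 1).add hind) hpt).trans ?_
  have : ∫ α, (1 + bad.indicator (fun _ => (n : ℝ)) α) ∂(thresholdLaw U) =
      1 + (thresholdLaw U).real bad * n := by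
    rw [integral_add (integrable_const _) hind, integral_indicator_const _ hbadm]
    simp
  refine (le_of_eq this).trans ?_
  have h := mul_le_mul_of_nonneg_right hbad hn'.le
  rw [one_div, inv_mul_cancel₀ hn'.ne'] at h
  linarith

/-! ### The rounded schedule -/

section Schedule

variable {U : Type*} [Fintype U] [LinearOrder U] {T : ℕ}

/-- The initial permutation is almost surely the rounding of its own matrix. -/
theorem ae_roundedSchedule_eq {π₀ : Ranking U} {A : Fin (T + 1) → PosMatrix U}
    (hA : A 0 = permMatrix π₀) (hL : 1 ≤ Real.log (Fintype.card U)) :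
    ∀ᵐ α ∂(thresholdLaw U), ∀ t, roundedSchedule π₀ A α t = sortRanking (roundIndex (A t) α) := by
  filter_upwards [ae_mem_Ioc] with α hα t
  refine Fin.cases ?_ (fun t => rfl) t
  rw [hA, sortRanking_roundIndex_permMatrix π₀ hL hα]
  rfl

theorem integrable_comp_roundedSchedule (π₀ : Ranking U) (A : Fin (T + 1) → PosMatrix U)
    (g : (Fin (T + 1) → Ranking U) → ℕ) {N : ℕ} (hg : ∀ σ, g σ ≤ N) :
    Integrable (fun α => (g (roundedSchedule π₀ A α) : ℝ)) (thresholdLaw U) :=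
  integrable_comp_roundIndex (fun t : Fin T => A t.succ)
    (fun I => g (Fin.cons π₀ fun t => sortRanking (I t))) fun _ => hg _

theorem integrable_movingCost (π₀ : Ranking U) (A : Fin (T + 1) → PosMatrix U) :
    Integrable (fun α => (movingCost (roundedSchedule π₀ A α) : ℝ)) (thresholdLaw U) :=
  integrable_comp_roundedSchedule π₀ A _ fun _ => Finset.sum_le_sum fun _ _ => kendallTau_le _ _

theorem integrable_coveringCost {R : Fin T → Finset U} (hR : ∀ t, (R t).Nonempty)
    (π₀ : Ranking U) (A : Fin (T + 1) → PosMatrix U) :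
    Integrable (fun α => (coveringCost R (roundedSchedule π₀ A α) : ℝ)) (thresholdLaw U) :=
  integrable_comp_roundedSchedule π₀ A _ fun _ =>
    Finset.sum_le_sum fun t _ => coverPos_le_card _ (hR t)

theorem integral_movingCost_le_fracMTFCost {π₀ : Ranking U} {A : Fin (T + 1) → PosMatrix U}
    (hA0 : A 0 = permMatrix π₀) (hA : ∀ t, IsBistochastic (A t))
    (hL : 1 ≤ Real.log (Fintype.card U)) :
    ∫ α, (movingCost (roundedSchedule π₀ A α) : ℝ) ∂(thresholdLaw U) ≤
      2 * Real.log (Fintype.card U) ^ 2 * fracMTFCost A := by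
  unfold movingCost fracMTFCost
  push_cast
  rw [integral_finsetSum _ fun t _ => integrable_comp_roundedSchedule π₀ A
    (fun σ => kendallTau (σ t.succ) (σ t.castSucc)) fun _ => kendallTau_le _ _, Finset.mul_sum]
  refine Finset.sum_le_sum fun t _ => ?_
  refine le_trans (le_of_eq (integral_congr_ae ?_))
    (integral_kendallTau_le (hA t.castSucc) (hA t.succ) hL)
  filter_upwards [ae_roundedSchedule_eq hA0 hL] with α hα
  rw [hα, hα]

theorem integral_coveringCost_le {R : Fin T → Finset U} (hR : ∀ t, (R t).Nonempty)
    {π₀ : Ranking U} {A : Fin (T + 1) → PosMatrix U} (hA : IsFracMTFFeasible R π₀ A)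
    (hL : 1 ≤ Real.log (Fintype.card U)) :
    ∫ α, (coveringCost R (roundedSchedule π₀ A α) : ℝ) ∂(thresholdLaw U) ≤ 2 * T := by
  unfold coveringCost
  push_cast
  rw [integral_finsetSum _ fun t _ => integrable_comp_roundedSchedule π₀ A
    (fun σ => coverPos (σ t.succ) (R t)) fun _ => coverPos_le_card _ (hR t)]
  refine (Finset.sum_le_sum fun t _ => integral_coverPos_le (hA.isBistochastic t.succ) hL (hR t)
    (hA.first_col t)).trans (le_of_eq ?_)
  simp [mul_comm]

theorem one_le_log_of_three_le {n : ℕ} (hn : 3 ≤ n) : 1 ≤ Real.log n := by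
  have h3 : (3 : ℝ) ≤ n := by exact_mod_cast hn
  rw [Real.le_log_iff_exp_le (by linarith)]
  linarith [Real.exp_one_lt_d9]

theorem integral_movingCost_le {R : Fin T → Finset U} (hR : ∀ t, (R t).Nonempty)
    {π₀ : Ranking U} {A : Fin (T + 1) → PosMatrix U} (hA : IsFracMTFOptimal R π₀ A) :
    ∫ α, (movingCost (roundedSchedule π₀ A α) : ℝ) ∂(thresholdLaw U) ≤
      4 * Real.log (Fintype.card U) ^ 2 * (optCost R π₀ : ℝ) := by
  obtain ⟨σ, hσ0, hσ⟩ := exists_isOptimalSolution R π₀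
  rcases le_or_gt 3 (Fintype.card U) with hn | hn
  · have hfrac := fracMTFCost_le_two_mul_totalCost hR hA hσ0
    rw [hσ] at hfrac
    refine (integral_movingCost_le_fracMTFCost hA.1.init hA.1.isBistochastic
      (one_le_log_of_three_le hn)).trans ?_
    refine (mul_le_mul_of_nonneg_left hfrac (by positivity)).trans (le_of_eq ?_)
    ring
  rcases le_or_gt (Fintype.card U) 1 with hn1 | hn1
  · have : ∀ α, movingCost (roundedSchedule π₀ A α) = 0 := fun α =>
      Finset.sum_eq_zero fun t _ => kendallTau_eq_zero hn1 _ _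
    simp only [this, Nat.cast_zero, integral_zero]
    positivity
  -- two elements: every round moves at most once and costs at least one
  have hcard : Fintype.card U = 2 := by omega
  have hle : ∀ α, (movingCost (roundedSchedule π₀ A α) : ℝ) ≤ T := fun α => by
    have := Finset.sum_le_sum fun (t : Fin T) (_ : t ∈ Finset.univ) =>
      kendallTau_le_one hcard.le (roundedSchedule π₀ A α t.succ)
        (roundedSchedule π₀ A α t.castSucc)
    have h : movingCost (roundedSchedule π₀ A α) ≤ T := by simpa [movingCost] using this
    exact_mod_cast h
  have hT : (T : ℝ) ≤ optCost R π₀ := by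
    have := le_coveringCost hR σ
    rw [← hσ, totalCost]
    exact_mod_cast this.trans (Nat.le_add_right _ _)
  have h1 := integral_mono (μ := thresholdLaw U) (integrable_movingCost π₀ A)
    (integrable_const (T : ℝ)) hle
  have h2 : ∫ _α, (T : ℝ) ∂(thresholdLaw U) = T := by simp
  rw [h2] at h1
  have h3 : (1 : ℝ) ≤ 4 * Real.log (Fintype.card U) ^ 2 := by
    rw [hcard]
    have := Real.log_two_gt_d9
    push_cast
    nlinarith
  refine h1.trans (hT.trans ?_)
  exact le_mul_of_one_le_left (Nat.cast_nonneg _) h3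

theorem integral_coveringCost_le_two_mul {R : Fin T → Finset U} (hR : ∀ t, (R t).Nonempty)
    {π₀ : Ranking U} {A : Fin (T + 1) → PosMatrix U} (hA : IsFracMTFFeasible R π₀ A)
    (σ : Fin (T + 1) → Ranking U) :
    ∫ α, (coveringCost R (roundedSchedule π₀ A α) : ℝ) ∂(thresholdLaw U) ≤
      2 * (coveringCost R σ : ℝ) := by
  have hT : (T : ℝ) ≤ coveringCost R σ := by exact_mod_cast le_coveringCost hR σ
  refine le_trans ?_ (mul_le_mul_of_nonneg_left hT zero_le_two)
  rcases le_or_gt 3 (Fintype.card U) with hn | hn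
  · exact integral_coveringCost_le hR hA (one_le_log_of_three_le hn)
  -- at most two elements: no position exceeds two
  have hle : ∀ α, (coveringCost R (roundedSchedule π₀ A α) : ℝ) ≤ 2 * T := fun α => by
    have := Finset.sum_le_sum fun (t : Fin T) (_ : t ∈ Finset.univ) =>
      (coverPos_le_card (roundedSchedule π₀ A α t.succ) (hR t)).trans (Nat.lt_succ_iff.1 hn)
    have h : coveringCost R (roundedSchedule π₀ A α) ≤ 2 * T := by
      simpa [coveringCost, mul_comm] using this
    exact_mod_cast h
  refine (integral_mono (μ := thresholdLaw U) (integrable_coveringCost hR π₀ A)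
    (integrable_const (2 * T : ℝ)) hle).trans (le_of_eq ?_)
  simp

end Schedule

end MultMSSC

theorem theorem2 :
    ∃ C : ℝ, 0 < C ∧
      ∀ (U : Type*) [Fintype U] [LinearOrder U] (T : ℕ) (R : Fin T → Finset U)
        (π₀ : MultMSSC.Ranking U) (A : Fin (T + 1) → MultMSSC.PosMatrix U),
        (∀ t, (R t).Nonempty) →
        MultMSSC.IsFracMTFOptimal R π₀ A →
        -- the random costs have an expectation
        Integrable (fun α => (MultMSSC.movingCost (MultMSSC.roundedSchedule π₀ A α) : ℝ))
          (MultMSSC.thresholdLaw U) ∧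
        Integrable (fun α => (MultMSSC.coveringCost R (MultMSSC.roundedSchedule π₀ A α) : ℝ))
          (MultMSSC.thresholdLaw U) ∧
        -- expected moving cost
        ∫ α, (MultMSSC.movingCost (MultMSSC.roundedSchedule π₀ A α) : ℝ)
            ∂(MultMSSC.thresholdLaw U) ≤
          4 * Real.log (Fintype.card U) ^ 2 * (MultMSSC.optCost R π₀ : ℝ) ∧
        -- expected covering cost
        (∀ σ : Fin (T + 1) → MultMSSC.Ranking U, MultMSSC.IsOptimalSolution R π₀ σ →
          ∫ α, (MultMSSC.coveringCost R (MultMSSC.roundedSchedule π₀ A α) : ℝ)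
              ∂(MultMSSC.thresholdLaw U) ≤
            2 * (MultMSSC.coveringCost R σ : ℝ)) ∧
        -- approximation ratio `O(log² n)`
        (2 ≤ Fintype.card U →
          ∫ α, (MultMSSC.totalCost R (MultMSSC.roundedSchedule π₀ A α) : ℝ)
              ∂(MultMSSC.thresholdLaw U) ≤
            C * Real.log (Fintype.card U) ^ 2 * (MultMSSC.optCost R π₀ : ℝ)) := by
  refine ⟨9, by norm_num, fun U _ _ T R π₀ A hR hA => ?_⟩
  have hmi := MultMSSC.integrable_movingCost π₀ A
  have hci := MultMSSC.integrable_coveringCost hR π₀ A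
  have hm := MultMSSC.integral_movingCost_le hR hA
  refine ⟨hmi, hci, hm, fun σ _ => MultMSSC.integral_coveringCost_le_two_mul hR hA.1 σ,
    fun hn => ?_⟩
  obtain ⟨σ, -, hσ⟩ := MultMSSC.exists_isOptimalSolution R π₀
  have hc := MultMSSC.integral_coveringCost_le_two_mul hR hA.1 σ
  have hcσ : (MultMSSC.coveringCost R σ : ℝ) ≤ MultMSSC.optCost R π₀ := by
    rw [← hσ, MultMSSC.totalCost]
    exact_mod_cast Nat.le_add_right _ _
  simp only [MultMSSC.totalCost, Nat.cast_add]
  rw [integral_add hci hmi]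
  -- `2 ≤ 5 * log² 2`, so the covering cost is absorbed
  have hlog : (2 : ℝ) ≤ 5 * Real.log (Fintype.card U) ^ 2 := by
    have h1 : Real.log 2 ≤ Real.log (Fintype.card U) :=
      Real.log_le_log two_pos (by exact_mod_cast hn)
    have h2 := Real.log_two_gt_d9
    nlinarith
  have h := mul_le_mul_of_nonneg_right hlog (Nat.cast_nonneg (MultMSSC.optCost R π₀) : (0 : ℝ) ≤ _)
  linarith
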